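/- Let $\mathbb{T}\subseteq\mathbb{R}$ be a time scale (a nonempty closed set) that is unbounded above, and write $I_{\mathbb{T}}=I\cap\mathbb{T}$ for an interval $I$. Each set $S=\mathbb{T}$ or closed $S=I_{\mathbb{T}}$ is regarded as a time scale with $\sigma(t)=\inf\{r\in S:r>t\}$ (and $\sigma(t)=t$ if $t=\max S$). A function $f$ on $S$ has $\Delta$-derivative $f^{\Delta}(t)$ at $t\in S$ if for every $\varepsilon>0$ one has $|f(\sigma(t))-f(r)-f^{\Delta}(t)(\sigma(t)-r)|\le\varepsilon|\sigma(t)-r|$ for all $r\in S$ in some neighbourhood of $t$; $f$ is rd-continuous if it is continuous at every right-dense point of $S$ (a point $t<\sup S$ with $\sigma(t)=t$) and has a finite left-sided limit at every left-dense point of $S$ (a point $t\in S$ that is a limit of points of $S$ smaller than $t$). For rd-continuous $f$, $\int_a^b f(\eta)\Delta\eta=F(b)-F(a)$, where $F^{\Delta}=f$. Let $t_0\in\mathbb{T}$, let $A:[t_0,\infty)_{\mathbb{T}}\to[0,\infty)$ and $\alpha:[t_0,\infty)_{\mathbb{T}}\to\mathbb{T}$ be rd-continuous with $\lim_{t\to\infty}\alpha(t)=\infty$,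 and for $t\in[t_0,\infty)_{\mathbb{T}}$ put $$\alpha_*(t)=\inf\{\alpha(\eta):\eta\in[t,\infty)_{\mathbb{T}}\},\qquad \alpha_{-1}(t)=\sup\{\eta\in[t_0,\infty)_{\mathbb{T}}:\alpha_*(\eta)\le t\}.$$ For $s\in[t_0,\infty)_{\mathbb{T}}$, a solution of the initial value problem $$x^{\Delta}(t)+A(t)x(\alpha(t))=0\ \ (t\in[s,\infty)_{\mathbb{T}}),\qquad x(s)=x_0,\qquad x(t)=\varphi(t)\ \ (t\in[\alpha_*(s),s)_{\mathbb{T}})\qquad(1)$$ is a function $x:[\alpha_*(s),\infty)_{\mathbb{T}}\to\mathbb{R}$ satisfying these equations that is rd-continuous on $[\alpha_*(s),s]_{\mathbb{T}}$ and $\Delta$-differentiable with rd-continuous derivative on $[s,\infty)_{\mathbb{T}}$ (each interval being regarded as a time scale of its own). Assume that * (A1) $\alpha(t)\le t$ for all $t\in[t_0,\infty)_{\mathbb{T}}$; * $\displaystyle\sup_{s\in[t_0,\infty)_{\mathbb{T}}}\int_s^{\alpha_{-1}(s)}A(\eta)\Delta\eta<\infty$; * $\displaystyle\sup_{t\in[t_0,\infty)_{\mathbb{T}}}\int_{\alpha_*(t)}^{\sigma(t)}A(\eta)\Delta\eta<1$,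 where $A$ is understood to vanish outside its domain, i.e. the lower limit is $\max\{\alpha_*(t),t_0\}$; * $\displaystyle\int_{t_0}^{\infty}A(\eta)\Delta\eta=\infty$. Then the trivial solution of $x^{\Delta}(t)+A(t)x(\alpha(t))=0$, $t\in[t_0,\infty)_{\mathbb{T}}$, is globally asymptotically stable, that is: * (uniform stability) for every $\varepsilon>0$ there is $\delta>0$ such that for every $s\in[t_0,\infty)_{\mathbb{T}}$, every solution $x$ of (1) with $|x_0|+\sup_{\eta\in[\alpha_*(s),s)_{\mathbb{T}}}|\varphi(\eta)|<\delta$ (the supremum over the empty set being $0$) satisfies $|x(t)|<\varepsilon$ for all $t\in[s,\infty)_{\mathbb{T}}$; and * (global attractivity) for every $s\in[t_0,\infty)_{\mathbb{T}}$, every solution $x$ of (1) satisfies $\lim_{t\to\infty}x(t)=0$. -/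

import Mathlib

/-! Delta calculus on a time scale and stability of a linear delay dynamic equation.

A time scale is a nonempty closed set of reals, represented here by `S : Set ℝ` or `T : Set ℝ`.
Functions on a time scale are represented by total functions `ℝ → ℝ`; every definition below uses
only the values at points of the time scale in question. -/

namespace TimeScale

/-- The forward jump operator `σ(t) = inf {s ∈ S : s > t}`, with `σ(t) = t` if `t` is the maximum
of `S`. -/
noncomputable def sigma (S : Set ℝ) (t : ℝ) : ℝ :=
  open Classical in if (S ∩ Set.Ioi t).Nonempty then sInf (S ∩ Set.Ioi t) else t

/-- The backward jump operator `ρ(t) = sup {s ∈ S : s < t}`, with `ρ(t) = t` if `t` is the minimum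
of `S`. -/
noncomputable def rho (S : Set ℝ) (t : ℝ) : ℝ :=
  open Classical in if (S ∩ Set.Iio t).Nonempty then sSup (S ∩ Set.Iio t) else t

/-- `t` is right-dense: it is not the maximum of `S`, and `σ(t) = t`. -/
def RightDense (S : Set ℝ) (t : ℝ) : Prop :=
  (S ∩ Set.Ioi t).Nonempty ∧ sigma S t = t

/-- `t` is left-dense: it is not the minimum of `S`, and `ρ(t) = t`. -/
def LeftDense (S : Set ℝ) (t : ℝ) : Prop :=
  (S ∩ Set.Iio t).Nonempty ∧ rho S t = t

/-- `f` is rd-continuous on the time scale `S`: it is continuous (on `S`) at every right-dense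
point of `S`, and has a finite left-sided limit (along `S`) at every left-dense point of `S`. -/
def RdContinuous (S : Set ℝ) (f : ℝ → ℝ) : Prop :=
  (∀ t ∈ S, RightDense S t → ContinuousWithinAt f S t) ∧
  (∀ t ∈ S, LeftDense S t → ∃ l : ℝ, Filter.Tendsto f (nhdsWithin t (S ∩ Set.Iio t)) (nhds l))

/-- `d` is the delta derivative of `f` at the point `t` of the time scale `S`. -/
def HasDeltaDerivAt (S : Set ℝ) (f : ℝ → ℝ) (d t : ℝ) : Prop :=
  ∀ ε : ℝ, 0 < ε → ∃ U ∈ nhds t, ∀ r ∈ U ∩ S,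
    |(f (sigma S t) - f r) - d * (sigma S t - r)| ≤ ε * |sigma S t - r|

/-- `F` is a delta antiderivative of `f` on `S`. (At a left-scattered maximum of `S` the condition
`HasDeltaDerivAt` holds for every value, so that point need not be excluded.) -/
def IsAntideriv (S : Set ℝ) (f F : ℝ → ℝ) : Prop :=
  ∀ t ∈ S, HasDeltaDerivAt S F (f t) t

/-- The delta integral `∫_a^b f(η) Δη = F(b) - F(a)` over the time scale `S`, where `F` is any
delta antiderivative of `f`, for `a, b ∈ S` and `f` rd-continuous on `S`. -/
noncomputable def deltaIntegral (S : Set ℝ) (f : ℝ → ℝ) (a b : ℝ) : ℝ :=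
  open Classical in
  if h : ∃ F : ℝ → ℝ, IsAntideriv S f F then h.choose b - h.choose a else 0

/-- The filter `t → ∞` along `T`. -/
def atInfty (T : Set ℝ) : Filter ℝ :=
  Filter.atTop ⊓ Filter.principal T

/-- `α_*(t) = inf {α(η) : η ∈ [t, ∞)_T}`. -/
noncomputable def alphaStar (T : Set ℝ) (α : ℝ → ℝ) (t : ℝ) : ℝ :=
  sInf (α '' (T ∩ Set.Ici t))

/-- `α_{-1}(t) = sup {η ∈ [t₀, ∞)_T : α_*(η) ≤ t}`. -/
noncomputable def alphaInv (T : Set ℝ) (t₀ : ℝ) (α : ℝ → ℝ) (t : ℝ) : ℝ :=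
  sSup {η | η ∈ T ∩ Set.Ici t₀ ∧ alphaStar T α η ≤ t}

/-- `x : [α_*(s), ∞)_T → ℝ` is a solution of `x^Δ(t) + A(t) x(α(t)) = 0` on `[s, ∞)_T`: it is
rd-continuous on the time scale `[α_*(s), s]_T`, and delta differentiable on the time scale
`[s, ∞)_T` with an rd-continuous derivative satisfying the equation. -/
def IsSolution (T : Set ℝ) (A α : ℝ → ℝ) (s : ℝ) (x : ℝ → ℝ) : Prop :=
  RdContinuous (T ∩ Set.Icc (alphaStar T α s) s) x ∧
  ∃ x' : ℝ → ℝ, RdContinuous (T ∩ Set.Ici s) x' ∧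
    ∀ t ∈ T ∩ Set.Ici s,
      HasDeltaDerivAt (T ∩ Set.Ici s) x (x' t) t ∧ x' t + A t * x (α t) = 0

/-- `x` is a solution of the initial value problem `x^Δ(t) + A(t) x(α(t)) = 0` for
`t ∈ [s, ∞)_T`, `x(s) = x₀`, and `x = φ` on `[α_*(s), s)_T`. -/
def IsIVPSolution (T : Set ℝ) (A α : ℝ → ℝ) (s x₀ : ℝ) (φ x : ℝ → ℝ) : Prop :=
  IsSolution T A α s x ∧ x s = x₀ ∧
    ∀ t ∈ T ∩ Set.Ico (alphaStar T α s) s, x t = φ t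

/-- `sup {|φ(η)| : η ∈ [α_*(s), s)_T}`, which is `0` if the interval is empty. (The initial
function of a solution is bounded, being rd-continuous on `[α_*(s), s]_T`.) -/
noncomputable def initialSup (T : Set ℝ) (α : ℝ → ℝ) (s : ℝ) (φ : ℝ → ℝ) : ℝ :=
  sSup ((fun η => |φ η|) '' (T ∩ Set.Ico (alphaStar T α s) s))

/-- The trivial solution is uniformly stable. -/
def UniformlyStable (T : Set ℝ) (t₀ : ℝ) (A α : ℝ → ℝ) : Prop :=
  ∀ ε : ℝ, 0 < ε → ∃ δ : ℝ, 0 < δ ∧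
    ∀ s ∈ T ∩ Set.Ici t₀, ∀ (x₀ : ℝ) (φ x : ℝ → ℝ), IsIVPSolution T A α s x₀ φ x →
      |x₀| + initialSup T α s φ < δ → ∀ t ∈ T ∩ Set.Ici s, |x t| < ε

/-- The trivial solution is globally attracting. -/
def GloballyAttracting (T : Set ℝ) (t₀ : ℝ) (A α : ℝ → ℝ) : Prop :=
  ∀ s ∈ T ∩ Set.Ici t₀, ∀ (x₀ : ℝ) (φ x : ℝ → ℝ), IsIVPSolution T A α s x₀ φ x →
    Filter.Tendsto x (atInfty T) (nhds 0)

/-- The trivial solution is globally asymptotically stable. -/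
def GloballyAsymptoticallyStable (T : Set ℝ) (t₀ : ℝ) (A α : ℝ → ℝ) : Prop :=
  UniformlyStable T t₀ A α ∧ GloballyAttracting T t₀ A α

end TimeScale

/-!
The theorem rests on one estimate, which uses that the integral of `A` over `[α_*(t), σ(t)]` is at
most some `l < 1`. Let `|x(α(r))| ≤ N` for `r` in `[a, t)` and let `x(a) ≤ D`, where `D ≥ 0`. Then
`x(t) ≤ D + l N`. Indeed, let `u` be the last point of `[a, t]` with `x(u) ≤ D`. On `(u, t]` the
solution is positive, so `x` can increase at `r` only if `α(r) ≤ u`; it then increases at most `N`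
times as fast as the integral of `A`, and the integral of `A` over `[u, σ(r)]` is at most `l`
because `α_*(r) ≤ u`. The total growth after `u` is therefore at most `l N`. This is
`IsDelaySolution.le_add_mul`, proved from the mean value inequality `le_of_deltaDeriv_nonpos`.

Applied to `x` and `-x` from the initial point, with `N` the supremum of `|x|` so far, the estimate
gives `N ≤ D + l N`, where `D` bounds the initial data. Hence `|x| ≤ D / (1 - l)`
(`IsDelaySolution.abs_le_div`), which is uniform stability and also bounds every solution.

For attractivity there are two cases. If `x` takes values `≤ 0` and values `≥ 0` arbitrarily late,
then the estimate with `D = 0`, started at such points, improves an eventual bound `B` on `|x|` to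
`l B`; iteration gives the limit `0` (`IsDelaySolution.eventually_abs_le_pow`). Otherwise `x` or `-x`
is eventually positive, hence eventually nonincreasing, and a positive lower bound would force it to
`-∞` since the integral of `A` diverges (`IsDelaySolution.tendsto_zero_of_eventually_pos`).

An antiderivative of `A` need not be constructed: if there were none, `deltaIntegral` would be
constantly `0`, contrary to the divergence hypothesis.
-/

namespace TimeScale

open Set Filter Topology

/-! ### The forward jump operator -/

lemma sigma_of_nonempty {S : Set ℝ} {t : ℝ} (h : (S ∩ Ioi t).Nonempty) :
    sigma S t = sInf (S ∩ Ioi t) := if_pos h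

lemma le_sigma (S : Set ℝ) (t : ℝ) : t ≤ sigma S t := by
  by_cases h : (S ∩ Ioi t).Nonempty
  · rw [sigma_of_nonempty h]
    exact le_csInf h fun r hr => hr.2.le
  · exact (if_neg h).ge

lemma bddBelow_inter_Ioi (S : Set ℝ) (t : ℝ) : BddBelow (S ∩ Ioi t) :=
  ⟨t, fun _ hr => hr.2.le⟩

lemma sigma_le {S : Set ℝ} {t r : ℝ} (hr : r ∈ S) (htr : t < r) : sigma S t ≤ r := by
  rw [sigma_of_nonempty ⟨r, hr, htr⟩]
  exact csInf_le (bddBelow_inter_Ioi S t) ⟨hr, htr⟩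

lemma sigma_mem {S : Set ℝ} (hS : IsClosed S) {t : ℝ} (ht : t ∈ S) : sigma S t ∈ S := by
  by_cases h : (S ∩ Ioi t).Nonempty
  · rw [sigma_of_nonempty h]
    exact hS.closure_subset_iff.2 inter_subset_left (csInf_mem_closure h (bddBelow_inter_Ioi S t))
  · rwa [show sigma S t = t from if_neg h]

lemma sigma_inter_Ici (T : Set ℝ) {s t : ℝ} (hst : s ≤ t) :
    sigma (T ∩ Ici s) t = sigma T t := by
  have : T ∩ Ici s ∩ Ioi t = T ∩ Ioi t := by
    ext r
    simp only [mem_inter_iff, mem_Ici, mem_Ioi]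
    constructor
    · rintro ⟨⟨h1, -⟩, h2⟩
      exact ⟨h1, h2⟩
    · rintro ⟨h1, h2⟩
      exact ⟨⟨h1, hst.trans h2.le⟩, h2⟩
  unfold sigma
  rw [this]

/-! ### Delta derivatives -/

lemma HasDeltaDerivAt.mono {S S' : Set ℝ} {f : ℝ → ℝ} {d t : ℝ} (h : HasDeltaDerivAt S f d t)
    (hsub : S' ⊆ S) (hσ : sigma S' t = sigma S t) : HasDeltaDerivAt S' f d t := by
  intro ε hε
  obtain ⟨U, hU, h⟩ := h ε hε
  rw [hσ]
  exact ⟨U, hU, fun r hr => h r ⟨hr.1, hsub hr.2⟩⟩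

lemma HasDeltaDerivAt.neg {S : Set ℝ} {f : ℝ → ℝ} {d t : ℝ} (h : HasDeltaDerivAt S f d t) :
    HasDeltaDerivAt S (fun r => -f r) (-d) t := by
  intro ε hε
  obtain ⟨U, hU, h⟩ := h ε hε
  refine ⟨U, hU, fun r hr => ?_⟩
  rw [← abs_neg]
  convert h r hr using 2
  ring

lemma HasDeltaDerivAt.sub_const_mul {S : Set ℝ} {f g : ℝ → ℝ} {d e t : ℝ}
    (hf : HasDeltaDerivAt S f d t) (hg : HasDeltaDerivAt S g e t) (C : ℝ) :
    HasDeltaDerivAt S (fun r => f r - C * g r) (d - C * e) t := by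
  intro ε hε
  have hC : 0 < |C| + 1 := by positivity
  obtain ⟨U, hU, h⟩ := hf (ε / 2) (by positivity)
  obtain ⟨V, hV, k⟩ := hg (ε / 2 / (|C| + 1)) (by positivity)
  refine ⟨U ∩ V, inter_mem hU hV, fun r hr => ?_⟩
  have h1 := h r ⟨hr.1.1, hr.2⟩
  have h2 := k r ⟨hr.1.2, hr.2⟩
  set P := f (sigma S t) - f r - d * (sigma S t - r)
  set Q := g (sigma S t) - g r - e * (sigma S t - r)
  have h3 : |C| * |Q| ≤ ε / 2 * |sigma S t - r| :=
    calc |C| * |Q| ≤ (|C| + 1) * (ε / 2 / (|C| + 1) * |sigma S t - r|) := by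
          gcongr
          linarith
      _ = ε / 2 * |sigma S t - r| := by field_simp
  calc _ = |P - C * Q| := by
        congr 1
        simp only [P, Q]
        ring
    _ ≤ |P| + |C| * |Q| := by
        rw [← abs_mul]
        exact abs_sub _ _
    _ ≤ ε * |sigma S t - r| := by linarith

/-- The increment of `f` over the gap between `t` and `σ(t)`. -/
lemma HasDeltaDerivAt.jump {S : Set ℝ} {f : ℝ → ℝ} {d t : ℝ} (h : HasDeltaDerivAt S f d t)
    (ht : t ∈ S) : f (sigma S t) - f t = d * (sigma S t - t) := by
  refine sub_eq_zero.1 (abs_eq_zero.1 (le_antisymm ?_ (abs_nonneg _)))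
  refine le_of_forall_pos_le_add fun δ hδ => ?_
  have hm : 0 < |sigma S t - t| + 1 := by positivity
  obtain ⟨U, hU, h⟩ := h (δ / (|sigma S t - t| + 1)) (by positivity)
  refine (h t ⟨mem_of_mem_nhds hU, ht⟩).trans ?_
  rw [zero_add, div_mul_eq_mul_div, div_le_iff₀ hm]
  nlinarith

lemma HasDeltaDerivAt.continuousWithinAt {S : Set ℝ} {f : ℝ → ℝ} {d t : ℝ}
    (h : HasDeltaDerivAt S f d t) (ht : t ∈ S) : ContinuousWithinAt f S t := by
  rw [ContinuousWithinAt, Metric.tendsto_nhds]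
  intro δ hδ
  set m := |sigma S t - t| with hm
  have hm0 : 0 ≤ m := abs_nonneg _
  obtain ⟨U, hU, hε⟩ := h (δ / (2 * (m + 1))) (by positivity)
  have hη : 0 < min 1 (δ / (2 * (|d| + 1))) := by positivity
  filter_upwards [nhdsWithin_le_nhds hU, self_mem_nhdsWithin,
    nhdsWithin_le_nhds (Metric.ball_mem_nhds t hη)] with r hrU hrS hrB
  rw [Metric.mem_ball, Real.dist_eq, lt_min_iff] at hrB
  have h1 := hε r ⟨hrU, hrS⟩
  have h2 := h.jump ht
  have h3 : |sigma S t - r| ≤ m + 1 := by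
    calc |sigma S t - r| = |(sigma S t - t) - (r - t)| := by ring_nf
      _ ≤ m + |r - t| := abs_sub _ _
      _ ≤ m + 1 := by linarith
  have h4 : δ / (2 * (m + 1)) * |sigma S t - r| ≤ δ / 2 := by
    calc _ ≤ δ / (2 * (m + 1)) * (m + 1) := by gcongr
      _ = δ / 2 := by field_simp
  have h5 : |d| * |r - t| < δ / 2 := by
    have := hrB.2
    rw [lt_div_iff₀ (by positivity)] at this
    nlinarith [abs_nonneg (r - t), abs_nonneg d]
  rw [Real.dist_eq]
  calc |f r - f t|
      = |d * (r - t) - (f (sigma S t) - f r - d * (sigma S t - r))| := by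
        congr 1
        linarith
    _ ≤ |d| * |r - t| + |f (sigma S t) - f r - d * (sigma S t - r)| := by
        rw [← abs_mul]
        exact abs_sub _ _
    _ < δ := by linarith

/-- The mean value inequality: a function with nonpositive delta derivative on `[a, b)` does not
increase from `a` to `b`. -/
theorem le_of_deltaDeriv_nonpos {S : Set ℝ} (hS : IsClosed S) {G g : ℝ → ℝ} {a b : ℝ}
    (ha : a ∈ S) (hb : b ∈ S) (hab : a ≤ b) (hG : ∀ r ∈ S, HasDeltaDerivAt S G (g r) r)
    (hg : ∀ r ∈ S, a ≤ r → r < b → g r ≤ 0) : G b ≤ G a := by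
  by_contra! hlt
  have hab' : a < b := lt_of_le_of_ne hab (by rintro rfl; exact lt_irrefl _ hlt)
  obtain ⟨ε, hε, hεb⟩ : ∃ ε > 0, G a + ε * (b - a) < G b := by
    have h1 : 0 < b - a := sub_pos.2 hab'
    refine ⟨(G b - G a) / (2 * (b - a)), by have := sub_pos.2 hlt; positivity, ?_⟩
    have : (G b - G a) / (2 * (b - a)) * (b - a) = (G b - G a) / 2 := by field_simp
    linarith
  -- Let `c` be the infimum `sInf W` of the points violating the bound `G r ≤ G a + ε (r - a)`.
  set W : Set ℝ := {r | r ∈ S ∧ a ≤ r ∧ r ≤ b ∧ G a + ε * (r - a) < G r} with hW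
  have hbW : b ∈ W := ⟨hb, hab, le_rfl, hεb⟩
  have hWb : BddBelow W := ⟨a, fun r hr => hr.2.1⟩
  have hcW : sInf W ∈ closure W := csInf_mem_closure ⟨b, hbW⟩ hWb
  have hac : a ≤ sInf W := le_csInf ⟨b, hbW⟩ fun r hr => hr.2.1
  have hcb : sInf W ≤ b := csInf_le hWb hbW
  have hgood : ∀ r ∈ S, a ≤ r → r < sInf W → G r ≤ G a + ε * (r - a) := by
    intro r hr har hrc
    by_contra! h
    exact absurd (csInf_le hWb ⟨hr, har, hrc.le.trans hcb, h⟩) (not_le.2 hrc)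
  have hmin : ∀ r ∈ W, sInf W ≤ r := fun r hr => csInf_le hWb hr
  generalize sInf W = c at *
  have hcS : c ∈ S := hS.closure_subset_iff.2 (fun r hr => hr.1) hcW
  -- If `c` violates the bound, it is reached from the left, by a jump or by continuity; otherwise
  -- it is right-dense, and the derivative at `c` controls the points to its right.
  by_cases hc : c ∈ W
  · have hbad := hc.2.2.2
    have hac' : a < c := lt_of_le_of_ne hac (by rintro rfl; simp at hbad)
    have hne : (S ∩ Ico a c).Nonempty := ⟨a, ha, le_rfl, hac'⟩
    have hbd : BddAbove (S ∩ Ico a c) := ⟨c, fun r hr => hr.2.2.le⟩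
    have hp := csSup_mem_closure hne hbd
    have hap : a ≤ sSup (S ∩ Ico a c) := le_csSup hbd ⟨ha, le_rfl, hac'⟩
    have hpc : sSup (S ∩ Ico a c) ≤ c := csSup_le hne fun r hr => hr.2.2.le
    have hmax : ∀ r ∈ S ∩ Ico a c, r ≤ sSup (S ∩ Ico a c) := fun r hr => le_csSup hbd hr
    generalize sSup (S ∩ Ico a c) = p at *
    have hpS : p ∈ S := hS.closure_subset_iff.2 inter_subset_left hp
    rcases hpc.lt_or_eq with hpc | rfl
    · have hσ : sigma S p = c := by
        refine le_antisymm (sigma_le hcS hpc) ?_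
        rw [sigma_of_nonempty ⟨c, hcS, hpc⟩]
        refine le_csInf ⟨c, hcS, hpc⟩ fun r hr => ?_
        by_contra! h
        exact absurd (hmax r ⟨hr.1, hap.trans hr.2.le, h⟩) (not_le.2 hr.2)
      have h1 := (hG p hpS).jump hpS
      rw [hσ] at h1
      have h2 := hgood p hpS hap hpc
      have h3 := hg p hpS hap (hpc.trans_le hcb)
      nlinarith [sub_pos.2 hpc]
    · have hcont : ContinuousWithinAt G (S ∩ Ico a p) p :=
        ((hG p hpS).continuousWithinAt hpS).mono inter_subset_left
      have : G p ≤ G a + ε * (p - a) :=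
        hcont.closure_le hp (by fun_prop : Continuous fun r => G a + ε * (r - a)).continuousWithinAt
          fun r hr => hgood r hr.1 hr.2.1 hr.2.2
      linarith
  · have hcgood : G c ≤ G a + ε * (c - a) := by
      by_contra! h
      exact hc ⟨hcS, hac, hcb, h⟩
    have hcb' : c < b := lt_of_le_of_ne hcb (by rintro rfl; exact hc hbW)
    have hgt : ∀ r ∈ W, c < r := fun r hr =>
      lt_of_le_of_ne (hmin r hr) (by rintro rfl; exact hc hr)
    have hσ : sigma S c = c := by
      refine le_antisymm ?_ (le_sigma S c)
      have : closure W ⊆ Ici (sigma S c) :=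
        closure_minimal (fun r hr => sigma_le hr.1 (hgt r hr)) isClosed_Ici
      exact this hcW
    obtain ⟨U, hU, h⟩ := hG c hcS ε hε
    obtain ⟨r, hrU, hrW⟩ := mem_closure_iff_nhds.1 hcW U hU
    have h1 := h r ⟨hrU, hrW.1⟩
    rw [hσ, abs_of_nonpos (by linarith [hgt r hrW] : c - r ≤ 0)] at h1
    have h2 := (abs_le.1 h1).1
    have h3 := hg c hcS hac hcb'
    have h4 := hrW.2.2.2
    nlinarith [hgt r hrW]

/-- Comparison of the increments of two functions through their delta derivatives. -/
theorem sub_le_of_deltaDeriv_le {S : Set ℝ} (hS : IsClosed S) {G g F f : ℝ → ℝ} {C a b : ℝ}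
    (ha : a ∈ S) (hb : b ∈ S) (hab : a ≤ b) (hG : ∀ r ∈ S, HasDeltaDerivAt S G (g r) r)
    (hF : ∀ r ∈ S, HasDeltaDerivAt S F (f r) r)
    (hg : ∀ r ∈ S, a ≤ r → r < b → g r ≤ C * f r) : G b - G a ≤ C * (F b - F a) := by
  have := le_of_deltaDeriv_nonpos hS ha hb hab
    (fun r hr => (hG r hr).sub_const_mul (hF r hr) C)
    (fun r hr h1 h2 => sub_nonpos.2 (hg r hr h1 h2))
  linarith

/-! ### Boundedness of rd-continuous functions -/

lemma RdContinuous.exists_bound {S : Set ℝ} {f : ℝ → ℝ} (hf : RdContinuous S f)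
    {K : Set ℝ} (hK : IsCompact K) (hKS : K ⊆ S) : ∃ M, ∀ r ∈ K, |f r| ≤ M := by
  have hbd : ∀ (l : Filter ℝ) (y : ℝ), Tendsto f l (𝓝 y) → ∃ M, ∀ᶠ r in l, |f r| ≤ M :=
    fun l y h => ⟨|y| + 1, (h.abs.eventually_lt_const (lt_add_one _)).mono fun r hr => hr.le⟩
  refine hK.induction_on (p := fun s => ∃ M, ∀ r ∈ s, |f r| ≤ M) ⟨0, by simp⟩
    (fun s t hst ⟨M, hM⟩ => ⟨M, fun r hr => hM r (hst hr)⟩)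
    (fun s t ⟨M, hM⟩ ⟨M', hM'⟩ => ⟨max M M', fun r hr => ?_⟩) fun t ht => ?_
  · rcases hr with hr | hr
    · exact (hM r hr).trans (le_max_left _ _)
    · exact (hM' r hr).trans (le_max_right _ _)
  have htS := hKS ht
  have hleft : ∃ M, ∀ᶠ r in 𝓝[S ∩ Iio t] t, |f r| ≤ M := by
    by_cases h : LeftDense S t
    · obtain ⟨l, hl⟩ := hf.2 t htS h
      exact hbd _ l hl
    refine ⟨0, ?_⟩
    by_cases hne : (S ∩ Iio t).Nonempty
    · have hρ : rho S t = sSup (S ∩ Iio t) := if_pos hne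
      have hlt : rho S t < t := by
        refine lt_of_le_of_ne ?_ fun h' => h ⟨hne, h'⟩
        rw [hρ]
        exact csSup_le hne fun r hr => hr.2.le
      filter_upwards [self_mem_nhdsWithin, nhdsWithin_le_nhds (Ioi_mem_nhds hlt)] with r hr hr'
      have : r ≤ rho S t := hρ ▸ le_csSup ⟨t, fun q hq => hq.2.le⟩ hr
      exact absurd this (not_le.2 hr')
    · rw [not_nonempty_iff_eq_empty.1 hne]
      simp
  have hright : ∃ M, ∀ᶠ r in 𝓝[S ∩ Ioi t] t, |f r| ≤ M := by
    by_cases h : RightDense S t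
    · exact hbd _ _ ((hf.1 t htS h).mono_left (nhdsWithin_mono t inter_subset_left))
    refine ⟨0, ?_⟩
    by_cases hne : (S ∩ Ioi t).Nonempty
    · have hlt : t < sigma S t := lt_of_le_of_ne (le_sigma S t) fun h' => h ⟨hne, h'.symm⟩
      filter_upwards [self_mem_nhdsWithin, nhdsWithin_le_nhds (Iio_mem_nhds hlt)] with r hr hr'
      exact absurd (sigma_le hr.1 hr.2) (not_le.2 hr')
    · rw [not_nonempty_iff_eq_empty.1 hne]
      simp
  obtain ⟨M₁, h₁⟩ := hleft
  obtain ⟨M₂, h₂⟩ := hright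
  rw [eventually_nhdsWithin_iff] at h₁ h₂
  refine ⟨{r | |f r| ≤ max |f t| (max M₁ M₂)}, ?_, max |f t| (max M₁ M₂), fun r hr => hr⟩
  filter_upwards [self_mem_nhdsWithin, nhdsWithin_le_nhds h₁, nhdsWithin_le_nhds h₂]
    with r hr h1 h2
  rcases lt_trichotomy r t with h | rfl | h
  · exact (h1 ⟨hKS hr, h⟩).trans (by simp)
  · exact le_max_left _ _
  · exact (h2 ⟨hKS hr, h⟩).trans (by simp)

/-! ### The growth bound for solutions -/

/-- If `x` grows at most `N` times as fast as `F`, and does not grow once the increment of `F` since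
`u` exceeds `l`, then `x` grows by at most `l * N`. The increment is measured at `σ(r)`, so that the
last step of growth, which may cross a gap, is included in the budget `l`. -/
lemma le_add_mul_of_deltaDeriv {S : Set ℝ} (hS : IsClosed S) {x x' F A : ℝ → ℝ} {u t N l : ℝ}
    (hu : u ∈ S) (ht : t ∈ S) (hut : u ≤ t)
    (hx : ∀ r ∈ S, HasDeltaDerivAt S x (x' r) r) (hF : ∀ r ∈ S, HasDeltaDerivAt S F (A r) r)
    (hA : ∀ r ∈ S, 0 ≤ A r) (hN : 0 ≤ N) (hl : 0 ≤ l)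
    (hN' : ∀ r ∈ S, u ≤ r → r < t → x' r ≤ N * A r)
    (h : ∀ r ∈ S, u ≤ r → r < t → l < F (sigma S r) - F u → x' r ≤ 0) :
    x t ≤ x u + l * N := by
  have hmono : ∀ p ∈ S, ∀ q ∈ S, p ≤ q → F p ≤ F q := by
    intro p hp q hq hpq
    have := le_of_deltaDeriv_nonpos hS hp hq hpq (fun r hr => (hF r hr).neg)
      (fun r hr _ _ => neg_nonpos.2 (hA r hr))
    linarith
  -- It suffices to split `[u, t]` at a point `w` before which `F` has grown by at most `l`,
  -- and after which `x` does not increase.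
  have key : ∀ w ∈ S, u ≤ w → w ≤ t → F w - F u ≤ l →
      x t ≤ x w → x t ≤ x u + l * N := by
    intro w hw huw hwt hFw hdec
    have h1 := sub_le_of_deltaDeriv_le hS hu hw huw hx hF
      (fun r hr h1 h2 => hN' r hr h1 (h2.trans_le hwt))
    nlinarith
  -- `V` is where growth is allowed; the splitting point is `σ(sup V)` if `sup V` is an element of `V`
  -- followed by a gap, and `sup V` otherwise.
  set V : Set ℝ := {r | r ∈ S ∧ u ≤ r ∧ r < t ∧ F (sigma S r) - F u ≤ l}
  rcases V.eq_empty_or_nonempty with hV | hV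
  · refine key u hu le_rfl hut (by linarith)
      (le_of_deltaDeriv_nonpos hS hu ht hut hx fun r hr h1 h2 => h r hr h1 h2 ?_)
    by_contra! h3
    exact (hV ▸ (⟨hr, h1, h2, h3⟩ : r ∈ V) : r ∈ (∅ : Set ℝ))
  have hVb : BddAbove V := ⟨t, fun r hr => hr.2.2.1.le⟩
  have hvV := csSup_mem_closure hV hVb
  have hvt : sSup V ≤ t := csSup_le hV fun r hr => hr.2.2.1.le
  have hmax : ∀ r ∈ V, r ≤ sSup V := fun r hr => le_csSup hVb hr
  generalize sSup V = v at *
  have huv : u ≤ v := by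
    obtain ⟨r, hr⟩ := hV
    exact hr.2.1.trans (hmax r hr)
  have hvS : v ∈ S := hS.closure_subset_iff.2 (fun r hr => hr.1) hvV
  have hafter : ∀ r ∈ S, u ≤ r → r < t → r ∉ V → x' r ≤ 0 := by
    intro r hr h1 h2 h3
    refine h r hr h1 h2 ?_
    by_contra! h4
    exact h3 ⟨hr, h1, h2, h4⟩
  have hdec : ∀ w ∈ S, v < w → w ≤ t → x t ≤ x w := fun w hw hvw hwt =>
    le_of_deltaDeriv_nonpos hS hw ht hwt hx fun r hr h1 h2 =>
      hafter r hr (huv.trans (hvw.le.trans h1)) h2 fun h3 =>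
        absurd (hmax r h3) (not_le.2 (hvw.trans_le h1))
  by_cases hv : v ∈ V
  · have hvt' := hv.2.2.1
    rcases (le_sigma S v).lt_or_eq with hσ | hσ
    · have hσt := sigma_le ht hvt'
      exact key _ (sigma_mem hS hvS) (huv.trans hσ.le) hσt hv.2.2.2
        (hdec _ (sigma_mem hS hvS) hσ hσt)
    · refine key v hvS huv hvt (by simpa [← hσ] using hv.2.2.2) ?_
      -- `v` is right-dense, so `x v` is a limit of values of `x` to the right of `v`.
      have hne : (S ∩ Ioi v).Nonempty := ⟨t, ht, hvt'⟩
      have hcl := csInf_mem_closure hne (bddBelow_inter_Ioi S v)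
      rw [← sigma_of_nonempty hne, ← hσ] at hcl
      by_contra! hlt
      have hev : ∀ᶠ r in 𝓝[S] v, x r < x t :=
        ((hx v hvS).continuousWithinAt hvS).eventually_lt_const hlt
      rw [eventually_nhdsWithin_iff] at hev
      obtain ⟨r, hr, hrS⟩ := mem_closure_iff_nhds.1 hcl _ (hev.and (Iio_mem_nhds hvt'))
      exact absurd (hdec r hrS.1 hrS.2 (mem_Iio.1 hr.2).le) (not_le.2 (hr.1 hrS.1))
  · refine key v hvS huv hvt ?_
      (le_of_deltaDeriv_nonpos hS hvS ht hvt hx fun r hr h1 h2 =>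
        hafter r hr (huv.trans h1) h2 fun h3 => hv (le_antisymm h1 (hmax r h3) ▸ h3))
    have hcont : ContinuousWithinAt F V v :=
      ((hF v hvS).continuousWithinAt hvS).mono fun r hr => hr.1
    have : F v ≤ F u + l := hcont.closure_le hvV continuousWithinAt_const fun r hr => by
      have := hmono r hr.1 _ (sigma_mem hS hr.1) (le_sigma S r)
      linarith [hr.2.2.2]
    linarith

/-- A solution `x`, with delta derivative `x'`, of `x^Δ(t) + A(t) x(α(t)) = 0` on a time scale `S`,
where `A ≥ 0` has the antiderivative `F` and the integral of `A` over `[u, σ(v)]` is at most `l`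
whenever `α(v) ≤ u ≤ v`. The values of `α` may leave `S` only to the left. -/
structure IsDelaySolution (S : Set ℝ) (A α F : ℝ → ℝ) (l : ℝ) (x x' : ℝ → ℝ) : Prop where
  closed : IsClosed S
  deriv : ∀ r ∈ S, HasDeltaDerivAt S x (x' r) r
  eqn : ∀ r ∈ S, x' r + A r * x (α r) = 0
  deriv_F : ∀ r ∈ S, HasDeltaDerivAt S F (A r) r
  nonneg : ∀ r ∈ S, 0 ≤ A r
  le_self : ∀ r ∈ S, α r ≤ r
  mem : ∀ r ∈ S, ∀ u ∈ S, u ≤ α r → α r ∈ S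
  l_nonneg : 0 ≤ l
  integral_le : ∀ u ∈ S, ∀ v ∈ S, u ≤ v → α v ≤ u → F (sigma S v) - F u ≤ l

namespace IsDelaySolution

variable {S : Set ℝ} {A α F : ℝ → ℝ} {l : ℝ} {x x' : ℝ → ℝ}

lemma neg (h : IsDelaySolution S A α F l x x') :
    IsDelaySolution S A α F l (fun r => -x r) (fun r => -x' r) :=
  { h with
    deriv := fun r hr => (h.deriv r hr).neg
    eqn := fun r hr => by linarith [h.eqn r hr] }

lemma continuousOn (h : IsDelaySolution S A α F l x x') : ContinuousOn x S :=
  fun r hr => (h.deriv r hr).continuousWithinAt hr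

/-- Beyond the last point `u` of `[a, t]` with `x u ≤ D`, the solution can grow only while `α`
still takes values at most `u`, hence by at most `l * N`. -/
lemma le_add_mul (h : IsDelaySolution S A α F l x x') {a t D N : ℝ} (ha : a ∈ S) (ht : t ∈ S)
    (hat : a ≤ t) (hD : 0 ≤ D) (hN : 0 ≤ N) (haD : x a ≤ D)
    (hbd : ∀ r ∈ S, a ≤ r → r < t → |x (α r)| ≤ N) : x t ≤ D + l * N := by
  have hlN := mul_nonneg h.l_nonneg hN
  by_cases htD : x t ≤ D
  · linarith
  have hclosed : IsClosed ((S ∩ Icc a t) ∩ x ⁻¹' Iic D) :=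
    (h.continuousOn.mono inter_subset_left).preimage_isClosed_of_isClosed
      (h.closed.inter isClosed_Icc) isClosed_Iic
  have hcompact : IsCompact ((S ∩ Icc a t) ∩ x ⁻¹' Iic D) :=
    isCompact_Icc.of_isClosed_subset hclosed fun r hr => hr.1.2
  obtain ⟨u, ⟨⟨huS, hau, hut⟩, huD⟩, hmax⟩ :=
    hcompact.exists_isGreatest ⟨a, ⟨ha, le_rfl, hat⟩, haD⟩
  have hpos : ∀ r ∈ S, u < r → r ≤ t → 0 < x r := by
    intro r hr hur hrt
    by_contra! hle
    exact absurd (hmax ⟨⟨hr, hau.trans hur.le, hrt⟩, hle.trans hD⟩) (not_le.2 hur)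
  have := le_add_mul_of_deltaDeriv h.closed huS ht hut h.deriv h.deriv_F h.nonneg hN h.l_nonneg
    (fun r hr h1 h2 => ?_) fun r hr h1 h2 h3 => ?_
  · have : x u ≤ D := huD
    linarith
  · have h4 := (abs_le.1 (hbd r hr (hau.trans h1) h2)).1
    nlinarith [h.eqn r hr, h.nonneg r hr]
  · have hlt : u < α r := by
      by_contra! hle
      linarith [h.integral_le u huS r hr h1 hle]
    have h4 := hpos _ (h.mem r hr u huS hlt.le) hlt ((h.le_self r hr).trans h2.le)
    nlinarith [h.eqn r hr, h.nonneg r hr]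

lemma abs_le_add_mul (h : IsDelaySolution S A α F l x x') {a t D N : ℝ} (ha : a ∈ S) (ht : t ∈ S)
    (hat : a ≤ t) (hN : 0 ≤ N) (haD : |x a| ≤ D)
    (hbd : ∀ r ∈ S, a ≤ r → r < t → |x (α r)| ≤ N) : |x t| ≤ D + l * N := by
  have hD := (abs_nonneg _).trans haD
  have h1 := h.le_add_mul ha ht hat hD hN (le_of_abs_le haD) hbd
  have h2 := h.neg.le_add_mul ha ht hat hD hN (neg_le.1 (abs_le.1 haD).1)
    (fun r hr h1 h2 => by simpa using hbd r hr h1 h2)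
  exact abs_le.2 ⟨by linarith, h1⟩

/-- If the maximum `N` of `|x|` on `[a, t]` exceeds the initial bound `D`, then `N ≤ D + l * N`. -/
lemma abs_le_div (h : IsDelaySolution S A α F l x x') (hl : l < 1) {a t D : ℝ} (ha : a ∈ S)
    (hmin : ∀ r ∈ S, a ≤ r) (ht : t ∈ S) (haD : |x a| ≤ D)
    (hinit : ∀ r ∈ S, α r < a → |x (α r)| ≤ D) : |x t| ≤ D / (1 - l) := by
  have hcompact : IsCompact (S ∩ Icc a t) :=
    isCompact_Icc.of_isClosed_subset (h.closed.inter isClosed_Icc) inter_subset_right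
  obtain ⟨m, ⟨hmS, ham, hmt⟩, hmax⟩ := hcompact.exists_isMaxOn ⟨a, ha, le_rfl, hmin t ht⟩
    (h.continuousOn.mono inter_subset_left).abs
  have hD := (abs_nonneg _).trans haD
  have hm : |x m| ≤ D + l * max D |x m| := by
    refine h.abs_le_add_mul ha hmS ham (le_max_of_le_left hD) haD fun r hr h1 h2 => ?_
    rcases lt_or_ge (α r) a with h3 | h3
    · exact (hinit r hr h3).trans (le_max_left _ _)
    · exact (hmax ⟨h.mem r hr a ha h3, h3, (h.le_self r hr).trans (h2.le.trans hmt)⟩).trans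
        (le_max_right _ _)
  have htm : |x t| ≤ |x m| := hmax ⟨ht, hmin t ht, le_rfl⟩
  rw [le_div_iff₀ (by linarith)]
  have h0 := h.l_nonneg
  rcases le_total D |x m| with h1 | h1
  · rw [max_eq_right h1] at hm
    nlinarith
  · nlinarith [abs_nonneg (x t)]

/-! ### Convergence to zero -/

/-- An eventually positive solution is eventually nonincreasing, and it cannot stay above a positive
constant because the integral of `A` diverges. -/
lemma tendsto_zero_of_eventually_pos (h : IsDelaySolution S A α F l x x')
    (hunb : ∀ R, ∃ t ∈ S, R ≤ t) (hα : ∀ R, ∃ R', ∀ r ∈ S, R' ≤ r → R ≤ α r)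
    (hF : ∀ M, ∃ R, ∀ r ∈ S, R ≤ r → M ≤ F r) {R₀ : ℝ} (hpos : ∀ r ∈ S, R₀ ≤ r → 0 < x r)
    {ε : ℝ} (hε : 0 < ε) : ∃ R, ∀ t ∈ S, R ≤ t → |x t| < ε := by
  obtain ⟨s, hs, hs0⟩ := hunb R₀
  -- Beyond any point of `S` there is another one after which `α` stays to the right of the first.
  have hshift : ∀ a ∈ S, ∃ b ∈ S, a ≤ b ∧ ∀ r ∈ S, b ≤ r → a ≤ α r ∧ α r ∈ S := by
    intro a ha
    obtain ⟨R, hR⟩ := hα a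
    obtain ⟨b, hb, hb'⟩ := hunb (max R a)
    refine ⟨b, hb, (le_max_right _ _).trans hb', fun r hr hbr => ?_⟩
    have := hR r hr ((le_max_left _ _).trans (hb'.trans hbr))
    exact ⟨this, h.mem r hr a ha this⟩
  obtain ⟨p, hp, hsp, hpα⟩ := hshift s hs
  have hanti : ∀ r ∈ S, ∀ t ∈ S, p ≤ r → r ≤ t → x t ≤ x r := by
    intro r hr t ht hpr hrt
    refine le_of_deltaDeriv_nonpos h.closed hr ht hrt h.deriv fun q hq h1 _ => ?_
    have h2 := hpα q hq (hpr.trans h1)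
    have := hpos _ h2.2 (hs0.trans h2.1)
    nlinarith [h.eqn q hq, h.nonneg q hq]
  obtain ⟨c, hc, hpc, hcε⟩ : ∃ c ∈ S, p ≤ c ∧ x c < ε := by
    by_contra! hge
    obtain ⟨q, hq, hpq, hqα⟩ := hshift p hp
    obtain ⟨R, hR⟩ := hF (F q + x q / ε)
    obtain ⟨t, ht, hRt⟩ := hunb (max R q)
    have h1 := hR t ht ((le_max_left _ _).trans hRt)
    have hqt := (le_max_right _ _).trans hRt
    have h2 := sub_le_of_deltaDeriv_le (C := -ε) h.closed hq ht hqt h.deriv h.deriv_F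
      fun r hr h3 _ => by
        have h4 := hqα r hr h3
        nlinarith [h.eqn r hr, h.nonneg r hr, hge _ h4.2 h4.1]
    have h3 := hpos t ht (hs0.trans (hsp.trans (hpq.trans hqt)))
    have h4 : ε * (x q / ε) = x q := by field_simp
    nlinarith
  refine ⟨c, fun t ht hct => ?_⟩
  rw [abs_of_pos (hpos t ht (hs0.trans (hsp.trans (hpc.trans hct))))]
  exact (hanti c hc t ht hpc hct).trans_lt hcε

/-- For an oscillating solution, each passage through zero improves an eventual bound on `|x|` by
the factor `l`. -/
lemma eventually_abs_le_pow (h : IsDelaySolution S A α F l x x')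
    (hα : ∀ R, ∃ R', ∀ r ∈ S, R' ≤ r → R ≤ α r)
    (hle : ∀ R, ∃ t ∈ S, R ≤ t ∧ x t ≤ 0) (hge : ∀ R, ∃ t ∈ S, R ≤ t ∧ 0 ≤ x t)
    {K : ℝ} (hK : 0 ≤ K) (hbd : ∀ r ∈ S, |x r| ≤ K) (n : ℕ) :
    ∃ R, ∀ t ∈ S, R ≤ t → |x t| ≤ l ^ n * K := by
  induction n with
  | zero => exact ⟨0, fun t ht _ => by simpa using hbd t ht⟩
  | succ n ih =>
    obtain ⟨R, hR⟩ := ih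
    obtain ⟨w, hw, hRw, -⟩ := hle R
    obtain ⟨R', hR'⟩ := hα w
    have hN : 0 ≤ l ^ n * K := mul_nonneg (pow_nonneg h.l_nonneg n) hK
    have hα' : ∀ r ∈ S, R' ≤ r → |x (α r)| ≤ l ^ n * K := fun r hr h1 =>
      hR _ (h.mem r hr w hw (hR' r hr h1)) (hRw.trans (hR' r hr h1))
    obtain ⟨a, ha, hRa, hxa⟩ := hle R'
    obtain ⟨b, hb, hRb, hxb⟩ := hge R'
    refine ⟨max a b, fun t ht hmt => ?_⟩
    have h1 := h.le_add_mul ha ht ((le_max_left _ _).trans hmt) le_rfl hN hxa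
      fun r hr h1 _ => hα' r hr (hRa.trans h1)
    have h2 := h.neg.le_add_mul hb ht ((le_max_right _ _).trans hmt) le_rfl hN
      (neg_nonpos.2 hxb) fun r hr h1 _ => by simpa using hα' r hr (hRb.trans h1)
    rw [abs_le, pow_succ']
    constructor <;> linarith

lemma tendsto_zero (h : IsDelaySolution S A α F l x x') (hl : l < 1)
    (hunb : ∀ R, ∃ t ∈ S, R ≤ t) (hα : ∀ R, ∃ R', ∀ r ∈ S, R' ≤ r → R ≤ α r)
    (hF : ∀ M, ∃ R, ∀ r ∈ S, R ≤ r → M ≤ F r) {K : ℝ} (hbd : ∀ r ∈ S, |x r| ≤ K)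
    {ε : ℝ} (hε : 0 < ε) : ∃ R, ∀ t ∈ S, R ≤ t → |x t| < ε := by
  by_cases hle : ∀ R, ∃ t ∈ S, R ≤ t ∧ x t ≤ 0
  · by_cases hge : ∀ R, ∃ t ∈ S, R ≤ t ∧ 0 ≤ x t
    · obtain ⟨s, hs, -⟩ := hunb 0
      have hK := (abs_nonneg _).trans (hbd s hs)
      have hlim : Tendsto (fun n : ℕ => l ^ n * K) atTop (𝓝 0) := by
        simpa using (tendsto_pow_atTop_nhds_zero_of_lt_one h.l_nonneg hl).mul_const K
      obtain ⟨n, hn⟩ := (hlim.eventually_lt_const hε).exists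
      obtain ⟨R, hR⟩ := h.eventually_abs_le_pow hα hle hge hK hbd n
      exact ⟨R, fun t ht hRt => (hR t ht hRt).trans_lt hn⟩
    · push Not at hge
      obtain ⟨R₀, hR₀⟩ := hge
      simpa using h.neg.tendsto_zero_of_eventually_pos hunb hα hF
        (fun r hr h1 => neg_pos.2 (hR₀ r hr h1)) hε
  · push Not at hle
    obtain ⟨R₀, hR₀⟩ := hle
    exact h.tendsto_zero_of_eventually_pos hunb hα hF hR₀ hε

end IsDelaySolution

/-! ### Time at infinity, the delay and the initial data -/

lemma eventually_atInfty {T : Set ℝ} {p : ℝ → Prop} :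
    (∀ᶠ t in atInfty T, p t) ↔ ∃ R, ∀ t ∈ T, R ≤ t → p t := by
  rw [atInfty, eventually_inf_principal, eventually_atTop]
  exact ⟨fun ⟨R, hR⟩ => ⟨R, fun t ht h => hR t h ht⟩, fun ⟨R, hR⟩ => ⟨R, fun t h ht => hR t ht h⟩⟩

lemma atInfty_neBot {T : Set ℝ} (hT : ¬ BddAbove T) : (atInfty T).NeBot := by
  refine ⟨fun h => ?_⟩
  obtain ⟨R, hR⟩ := eventually_atInfty.1 (h ▸ eventually_bot : ∀ᶠ t in atInfty T, False)
  exact hT ⟨R, fun t ht => (lt_of_not_ge (hR t ht)).le⟩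

lemma bddBelow_image_alpha {T : Set ℝ} (hT : IsClosed T) {t₀ s : ℝ} {α : ℝ → ℝ}
    (hα : RdContinuous (T ∩ Ici t₀) α) (hα_lim : Tendsto α (atInfty T) atTop) (hs : t₀ ≤ s) :
    BddBelow (α '' (T ∩ Ici s)) := by
  obtain ⟨R, hR⟩ := eventually_atInfty.1 (hα_lim.eventually_ge_atTop 0)
  obtain ⟨M, hM⟩ := hα.exists_bound (K := T ∩ Icc t₀ R)
    (isCompact_Icc.of_isClosed_subset (hT.inter isClosed_Icc) inter_subset_right)
    (inter_subset_inter_right T Icc_subset_Ici_self)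
  refine ⟨min 0 (-M), ?_⟩
  rintro _ ⟨r, ⟨hrT, hsr⟩, rfl⟩
  rcases le_total R r with h | h
  · exact (min_le_left _ _).trans (hR r hrT h)
  · exact (min_le_right _ _).trans (neg_le_of_abs_le (hM r ⟨hrT, hs.trans hsr, h⟩))

lemma alphaStar_mem {T : Set ℝ} (hT : IsClosed T) {s : ℝ} {α : ℝ → ℝ} (hs : s ∈ T)
    (hmem : ∀ r ∈ T ∩ Ici s, α r ∈ T) (hb : BddBelow (α '' (T ∩ Ici s))) :
    alphaStar T α s ∈ T :=
  hT.closure_subset_iff.2 (image_subset_iff.2 hmem)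
    (csInf_mem_closure ⟨α s, mem_image_of_mem α ⟨hs, mem_Ici.2 le_rfl⟩⟩ hb)

lemma alphaStar_le {T : Set ℝ} {s r : ℝ} {α : ℝ → ℝ} (hb : BddBelow (α '' (T ∩ Ici s)))
    (hr : r ∈ T ∩ Ici s) : alphaStar T α s ≤ α r :=
  csInf_le hb (mem_image_of_mem α hr)

/-- The initial function of a solution is bounded, so `initialSup` bounds it. -/
lemma abs_le_initialSup {T : Set ℝ} (hT : IsClosed T) {A α φ x : ℝ → ℝ} {s x₀ η : ℝ}
    (hx : IsIVPSolution T A α s x₀ φ x) (hη : η ∈ T ∩ Ico (alphaStar T α s) s) :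
    |x η| ≤ initialSup T α s φ := by
  obtain ⟨M, hM⟩ := hx.1.1.exists_bound (K := T ∩ Icc (alphaStar T α s) s)
    (isCompact_Icc.of_isClosed_subset (hT.inter isClosed_Icc) inter_subset_right) Subset.rfl
  rw [hx.2.2 η hη]
  refine le_csSup ⟨M, ?_⟩ (mem_image_of_mem (fun η => |φ η|) hη)
  rintro _ ⟨r, hr, rfl⟩
  simpa only [← hx.2.2 r hr] using hM r ⟨hr.1, Ico_subset_Icc_self hr.2⟩

lemma initialSup_nonneg (T : Set ℝ) (α φ : ℝ → ℝ) (s : ℝ) : 0 ≤ initialSup T α s φ :=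
  Real.sSup_nonneg (by rintro _ ⟨r, -, rfl⟩; exact abs_nonneg _)

/-- Divergence of the integral excludes the junk value of `deltaIntegral`, so the integrand has an
antiderivative. -/
lemma exists_deltaIntegral_eq {T S : Set ℝ} (hT : ¬ BddAbove T) {A : ℝ → ℝ} {a : ℝ}
    (h : Tendsto (fun t => deltaIntegral S A a t) (atInfty T) atTop) :
    ∃ F, IsAntideriv S A F ∧ ∀ p q, deltaIntegral S A p q = F q - F p := by
  by_cases hF : ∃ F : ℝ → ℝ, IsAntideriv S A F
  · exact ⟨hF.choose, hF.choose_spec, fun p q => by rw [deltaIntegral, dif_pos hF]⟩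
  · have := atInfty_neBot hT
    obtain ⟨t, ht⟩ := (h.eventually_gt_atTop 0).exists
    rw [deltaIntegral, dif_neg hF] at ht
    exact absurd ht (lt_irrefl 0)

/-- A supremum below `1` in the extended reals is dominated by a real `l ∈ [0, 1)`. -/
lemma exists_le_of_iSup_lt_one {S : Set ℝ} {f : ℝ → ℝ}
    (h : (⨆ t ∈ S, ((f t : ℝ) : EReal)) < 1) : ∃ l, 0 ≤ l ∧ l < 1 ∧ ∀ t ∈ S, f t ≤ l := by
  obtain ⟨l, hl, hl'⟩ := EReal.lt_iff_exists_real_btwn.1 h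
  refine ⟨max 0 l, le_max_left _ _, max_lt one_pos (by exact_mod_cast hl'), fun t ht => ?_⟩
  have h1 : (f t : EReal) ≤ ⨆ t ∈ S, ((f t : ℝ) : EReal) := le_iSup₂_of_le t ht le_rfl
  exact (EReal.coe_le_coe_iff.1 (h1.trans hl.le)).trans (le_max_right _ _)

end TimeScale

theorem mainTheorem1 (T : Set ℝ) (hT : IsClosed T) (hTtop : ¬ BddAbove T)
    (t₀ : ℝ) (ht₀ : t₀ ∈ T) (A α : ℝ → ℝ)
    (hA : TimeScale.RdContinuous (T ∩ Set.Ici t₀) A)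
    (hA_nonneg : ∀ t ∈ T ∩ Set.Ici t₀, 0 ≤ A t)
    (hα : TimeScale.RdContinuous (T ∩ Set.Ici t₀) α)
    (hα_mem : ∀ t ∈ T ∩ Set.Ici t₀, α t ∈ T)
    (hα_lim : Filter.Tendsto α (TimeScale.atInfty T) Filter.atTop)
    (hα_le : ∀ t ∈ T ∩ Set.Ici t₀, α t ≤ t)
    (h_bdd : (⨆ s ∈ T ∩ Set.Ici t₀,
      ((TimeScale.deltaIntegral (T ∩ Set.Ici t₀) A s
        (TimeScale.alphaInv T t₀ α s) : ℝ) : EReal)) < ⊤)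
    (h_lt_one : (⨆ t ∈ T ∩ Set.Ici t₀,
      ((TimeScale.deltaIntegral (T ∩ Set.Ici t₀) A
        (max (TimeScale.alphaStar T α t) t₀) (TimeScale.sigma T t) : ℝ) : EReal)) < 1)
    (h_div : Filter.Tendsto (fun t => TimeScale.deltaIntegral (T ∩ Set.Ici t₀) A t₀ t)
      (TimeScale.atInfty T) Filter.atTop) :
    TimeScale.GloballyAsymptoticallyStable T t₀ A α := by
  open TimeScale Set Filter Topology in
  obtain ⟨F, hF, hint⟩ := exists_deltaIntegral_eq hTtop h_div
  obtain ⟨l, hl0, hl1, hl⟩ := exists_le_of_iSup_lt_one h_lt_one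
  have hS₀ : IsClosed (T ∩ Ici t₀) := hT.inter isClosed_Ici
  have hb : ∀ s, t₀ ≤ s → BddBelow (α '' (T ∩ Ici s)) := fun s hs =>
    bddBelow_image_alpha hT hα hα_lim hs
  have hsub : ∀ s, t₀ ≤ s → T ∩ Ici s ⊆ T ∩ Ici t₀ := fun s hs =>
    inter_subset_inter_right T (Ici_subset_Ici.2 hs)
  have hmono : ∀ p ∈ T ∩ Ici t₀, ∀ q ∈ T ∩ Ici t₀, p ≤ q → F p ≤ F q := by
    intro p hp q hq hpq
    have := sub_le_of_deltaDeriv_le (C := 0) hS₀ hp hq hpq (fun r hr => (hF r hr).neg) hF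
      fun r hr _ _ => by linarith [hA_nonneg r hr]
    linarith
  have hsol : ∀ s ∈ T ∩ Ici t₀, ∀ x₀ φ x, IsIVPSolution T A α s x₀ φ x →
      ∃ x', IsDelaySolution (T ∩ Ici s) A α F l x x' := by
    rintro s ⟨hsT, hs⟩ x₀ φ x ⟨⟨-, x', -, hx'⟩, -, -⟩
    refine ⟨x', hT.inter isClosed_Ici, fun r hr => (hx' r hr).1, fun r hr => (hx' r hr).2,
      fun r hr => (hF r (hsub s hs hr)).mono (hsub s hs) ?_,
      fun r hr => hA_nonneg r (hsub s hs hr), fun r hr => hα_le r (hsub s hs hr),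
      fun r hr u hu hur => ⟨hα_mem r (hsub s hs hr), le_trans hu.2 hur⟩, hl0,
      fun u hu v hv huv hαv => ?_⟩
    · rw [sigma_inter_Ici T hr.2, sigma_inter_Ici T (hs.trans hr.2)]
    · have hv₀ := hsub s hs hv
      have h1 := hl v hv₀
      rw [hint] at h1
      rw [sigma_inter_Ici T hv.2]
      have h2 : max (alphaStar T α v) t₀ ∈ T ∩ Ici t₀ := by
        refine ⟨?_, mem_Ici.2 (le_max_right _ _)⟩
        rcases max_choice (alphaStar T α v) t₀ with h | h
        · rw [h]
          exact alphaStar_mem hT hv.1 (fun r hr => hα_mem r (hsub v hv₀.2 hr)) (hb v hv₀.2)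
        · rwa [h]
      have h3 := hmono _ h2 u (hsub s hs hu)
        (max_le ((alphaStar_le (hb v hv₀.2) ⟨hv.1, mem_Ici.2 le_rfl⟩).trans hαv) (hs.trans hu.2))
      linarith
  have hbound : ∀ s ∈ T ∩ Ici t₀, ∀ x₀ φ x, IsIVPSolution T A α s x₀ φ x →
      ∀ t ∈ T ∩ Ici s, |x t| ≤ (|x₀| + initialSup T α s φ) / (1 - l) := by
    rintro s hs x₀ φ x hx t ht
    obtain ⟨x', h⟩ := hsol s hs x₀ φ x hx
    refine h.abs_le_div hl1 ⟨hs.1, mem_Ici.2 le_rfl⟩ (fun r hr => hr.2) ht ?_ fun r hr hαr => ?_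
    · rw [hx.2.1]
      linarith [initialSup_nonneg T α φ s]
    · have := abs_le_initialSup hT hx
        ⟨hα_mem r (hsub s hs.2 hr), alphaStar_le (hb s hs.2) hr, hαr⟩
      linarith [abs_nonneg x₀]
  refine ⟨fun ε hε => ⟨ε * (1 - l), mul_pos hε (sub_pos.2 hl1), ?_⟩, ?_⟩
  · intro s hs x₀ φ x hx hδ t ht
    refine (hbound s hs x₀ φ x hx t ht).trans_lt ?_
    rwa [div_lt_iff₀ (sub_pos.2 hl1)]
  · intro s hs x₀ φ x hx
    obtain ⟨x', h⟩ := hsol s hs x₀ φ x hx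
    have hunb : ∀ R, ∃ t ∈ T ∩ Ici s, R ≤ t := by
      intro R
      obtain ⟨t, ht, hlt⟩ := not_bddAbove_iff.1 hTtop (max R s)
      exact ⟨t, ⟨ht, (le_max_right _ _).trans hlt.le⟩, (le_max_left _ _).trans hlt.le⟩
    rw [Metric.tendsto_nhds]
    intro ε hε
    obtain ⟨R, hR⟩ := h.tendsto_zero hl1 hunb
      (fun R => by
        obtain ⟨R', hR'⟩ := eventually_atInfty.1 (hα_lim.eventually_ge_atTop R)
        exact ⟨R', fun r hr => hR' r hr.1⟩)
      (fun M => by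
        obtain ⟨R, hR⟩ := eventually_atInfty.1 (h_div.eventually_ge_atTop (M - F t₀))
        refine ⟨R, fun r hr hRr => ?_⟩
        have := hR r hr.1 hRr
        rw [hint] at this
        linarith)
      (hbound s hs x₀ φ x hx) hε
    refine eventually_atInfty.2 ⟨max R s, fun t ht hRt => ?_⟩
    rw [Real.dist_eq, sub_zero]
    exact hR t ⟨ht, (le_max_right _ _).trans hRt⟩ ((le_max_left _ _).trans hRt)
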